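/- Let $\Gamma$ be a finite, compact, connected metric graph with vertex set $V$ and edge set $E$, $|E|\ge 2$ (loops and multiple edges are allowed; a vertex is a nonempty set of endpoints of edges), with edge lengths $\ell_1\ge\ell_2\ge\dots\ge\ell_{|E|}>0$, and let $\alpha'_v\in\mathbb R\setminus\{0\}$ for $v\in V$. Let $\lambda_1(\Gamma^{\delta'})\le\lambda_2(\Gamma^{\delta'})\le\dots$ be the eigenvalues, counted with multiplicity, of the Laplacian $-\frac{d^2}{dx^2}$ in $\bigoplus_{e}L^2(0,\ell_e)$ on the functions $\varphi\in\bigoplus_{e}H^2(0,\ell_e)$ that satisfy the $\delta'$ conditions at every vertex $v$: the derivatives $\partial\varphi(x)$, taken into the edges, have a common value $\partial\varphi(v)$ at all endpoints $x\in v$, and $\sum_{x\in v}\varphi(x)=\alpha'_v\,\partial\varphi(v)$. Let $1\le j\le|E|$, and let $k$ be a real number such that (a) $k\in\{1,2,3,\dots\}$ and $\alpha'_v>0$ for all $v\in V$, or (b) $k-\left(1+\frac{|V|+1}{|E|}\right)\in\{0,1,2,\dots\}$ (and the nonzero strengths $\alpha'_v$ may have any signs). Then $k|E|+j$ is a positive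 integer and $$\min\left\{\frac{\left(2\left(k-\left(1+\frac{|V|+1}{|E|}\right)\right)+3\right)^2\pi^2}{4\ell_1^2},\ \frac{\left(2\left(k-\left(1+\frac{|V|+1}{|E|}\right)\right)+1\right)^2\pi^2}{4\ell_j^2}\right\}\le\lambda_{k|E|+j}(\Gamma^{\delta'}).$$ -/

import Mathlib

open MeasureTheory

/-- A finite compact metric graph with vertex set `V` and edge set `E` (both are finite in all uses).
The edge `e` is the interval `[0, length e]`; its two endpoints are `(e, false)`, the left endpoint
`x = 0`, and `(e, true)`, the right endpoint `x = length e`. A vertex is a nonempty class of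
endpoints: `vertex` sends an endpoint to the vertex that contains it. Loops and multiple edges are
allowed. -/
structure MetricGraph (V E : Type*) where
  length : E → ℝ
  length_pos : ∀ e, 0 < length e
  vertex : E × Bool → V
  vertex_surjective : Function.Surjective vertex

namespace MetricGraph

variable {V E : Type*}

/-- Any two vertices are joined by a chain of edges (and there is at least one vertex). -/
def IsConnected (Γ : MetricGraph V E) : Prop :=
  (SimpleGraph.fromRel fun v w => ∃ e, Γ.vertex (e, false) = v ∧ Γ.vertex (e, true) = w).Connected

/-- The Hilbert space `L²(Γ) = ⨁ₑ L²(0, ℓₑ)` of complex-valued functions. -/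
abbrev L2 [Fintype E] (Γ : MetricGraph V E) : Type _ :=
  PiLp 2 fun e : E => Lp ℂ 2 (volume.restrict (Set.Ioc 0 (Γ.length e)))

/-- The value `φ(x)` of a function at an endpoint. -/
def endValue (Γ : MetricGraph V E) (φ : E → ℝ → ℂ) : E × Bool → ℂ
  | (e, false) => φ e 0
  | (e, true) => φ e (Γ.length e)

/-- The derivative `∂φ(x)` at an endpoint, taken into the edge, for `p = φ'`. -/
def endDeriv (Γ : MetricGraph V E) (p : E → ℝ → ℂ) : E × Bool → ℂ
  | (e, false) => p e 0
  | (e, true) => -p e (Γ.length e)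

/-- `φ` is the `C¹` representative of an element of `⨁ₑ H²(0, ℓₑ)`, with first derivative `φ' = p`
and second derivative `φ'' = -w`: `φ'` is absolutely continuous with the square-integrable
derivative `-w`. -/
def IsH2Rep [Fintype E] (Γ : MetricGraph V E) (φ p : E → ℝ → ℂ) (w : Γ.L2) : Prop :=
  ∀ e, ∀ x ∈ Set.Icc 0 (Γ.length e),
    HasDerivWithinAt (φ e) (p e x) (Set.Icc 0 (Γ.length e)) x ∧
    p e x = p e 0 - ∫ t in (0 : ℝ)..x, (w e : ℝ → ℂ) t

open Classical in
/-- The `δ'` vertex conditions with strengths `α`, for a function `φ` with `φ' = p`: at each vertex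
all the derivatives `∂φ(x)`, `x ∈ v`, agree, and `∑_{x ∈ v} φ(x) = α_v ∂φ(v)`. -/
def DeltaPrimeCondition [Fintype E] (Γ : MetricGraph V E) (α : V → ℝ) (φ p : E → ℝ → ℂ) : Prop :=
  (∀ x y, Γ.vertex x = Γ.vertex y → Γ.endDeriv p x = Γ.endDeriv p y) ∧
  ∀ x, ∑ y with Γ.vertex y = Γ.vertex x, Γ.endValue φ y = α (Γ.vertex x) * Γ.endDeriv p x

lemma intervalIntegrable_L2 [Fintype E] (Γ : MetricGraph V E) (w : Γ.L2) (e : E) {x : ℝ}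
    (hx : x ∈ Set.Icc 0 (Γ.length e)) :
    IntervalIntegrable (w e : ℝ → ℂ) volume 0 x := by
  rw [intervalIntegrable_iff_integrableOn_Ioc_of_le hx.1]
  have h : IntegrableOn (w e : ℝ → ℂ) (Set.Ioc 0 (Γ.length e)) volume :=
    (Lp.memLp (w e)).integrable (by norm_num)
  exact h.mono_set (Set.Ioc_subset_Ioc_right hx.2)

lemma ae_Ioc_of_ae [Fintype E] (Γ : MetricGraph V E) (e : E) {x : ℝ}
    (hx : x ∈ Set.Icc 0 (Γ.length e)) {P : ℝ → Prop}
    (h : ∀ᵐ t ∂(volume.restrict (Set.Ioc 0 (Γ.length e))), P t) :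
    ∀ᵐ t, t ∈ Set.uIoc 0 x → P t := by
  rw [ae_restrict_iff' measurableSet_Ioc] at h
  filter_upwards [h] with t ht hmem
  rw [Set.uIoc_of_le hx.1] at hmem
  exact ht ⟨hmem.1, hmem.2.trans hx.2⟩

/-- The graph `{(u, -u'')}` of the Laplacian `-d²/dx²` in `L²(Γ)` whose domain consists of the
functions in `⨁ₑ H²(0, ℓₑ)` that satisfy the `δ'` conditions with strengths `α`. -/
def deltaPrimeLaplacianGraph [Fintype E] (Γ : MetricGraph V E) (α : V → ℝ) :
    Submodule ℂ (Γ.L2 × Γ.L2) where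
  carrier := {uw | ∃ φ p : E → ℝ → ℂ,
    (∀ e, (uw.1 e : ℝ → ℂ) =ᵐ[volume.restrict (Set.Ioc 0 (Γ.length e))] φ e) ∧
    Γ.IsH2Rep φ p uw.2 ∧ Γ.DeltaPrimeCondition α φ p}
  zero_mem' := by
    refine ⟨fun _ _ => 0, fun _ _ => 0, fun e => ?_, fun e x hx => ⟨?_, ?_⟩, ?_, ?_⟩
    · exact Lp.coeFn_zero _ _ _
    · exact hasDerivWithinAt_const _ _ _
    · have : ∫ t in (0 : ℝ)..x, ((0 : Lp ℂ 2 (volume.restrict (Set.Ioc 0 (Γ.length e)))) : ℝ → ℂ) t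
          = 0 := by
        rw [intervalIntegral.integral_congr_ae (g := fun _ => (0 : ℂ))
          (Γ.ae_Ioc_of_ae e hx (Lp.coeFn_zero ℂ 2 _))]
        simp
      simpa using this
    · rintro ⟨a, _ | _⟩ ⟨b, _ | _⟩ _ <;> simp [endDeriv]
    · have h0 : ∀ y, Γ.endValue (fun _ _ => 0) y = 0 := by
        rintro ⟨b, _ | _⟩ <;> rfl
      have h1 : ∀ y, Γ.endDeriv (fun _ _ => 0) y = 0 := by
        rintro ⟨b, _ | _⟩ <;> simp [endDeriv]
      intro x
      simp [h0, h1]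
  add_mem' := by
    rintro ⟨u, w⟩ ⟨u', w'⟩ ⟨φ, p, h1, h2, h3, h4⟩ ⟨φ', p', h1', h2', h3', h4'⟩
    have hv : ∀ y, Γ.endValue (fun e x => φ e x + φ' e x) y
        = Γ.endValue φ y + Γ.endValue φ' y := by
      rintro ⟨b, _ | _⟩ <;> rfl
    have hd : ∀ y, Γ.endDeriv (fun e x => p e x + p' e x) y
        = Γ.endDeriv p y + Γ.endDeriv p' y := by
      rintro ⟨b, _ | _⟩ <;> (simp [endDeriv]; try ring)
    refine ⟨fun e x => φ e x + φ' e x, fun e x => p e x + p' e x, fun e => ?_,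
      fun e x hx => ⟨?_, ?_⟩, ?_, ?_⟩
    · filter_upwards [Lp.coeFn_add (u e) (u' e), h1 e, h1' e] with t ht ht1 ht2
      have : ((u + u') e : ℝ → ℂ) t = (u e : ℝ → ℂ) t + (u' e : ℝ → ℂ) t := ht
      exact this.trans (by rw [ht1, ht2])
    · exact (h2 e x hx).1.add (h2' e x hx).1
    · have : ∫ t in (0 : ℝ)..x, ((w e + w' e :
          Lp ℂ 2 (volume.restrict (Set.Ioc 0 (Γ.length e)))) : ℝ → ℂ) t
          = (∫ t in (0 : ℝ)..x, (w e : ℝ → ℂ) t) + ∫ t in (0 : ℝ)..x, (w' e : ℝ → ℂ) t := by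
        rw [← intervalIntegral.integral_add (Γ.intervalIntegrable_L2 w e hx)
          (Γ.intervalIntegrable_L2 w' e hx)]
        exact intervalIntegral.integral_congr_ae
          (Γ.ae_Ioc_of_ae e hx (Lp.coeFn_add (w e) (w' e)))
      change p e x + p' e x = p e 0 + p' e 0 - ∫ t in (0 : ℝ)..x, ((w e + w' e :
          Lp ℂ 2 (volume.restrict (Set.Ioc 0 (Γ.length e)))) : ℝ → ℂ) t
      rw [this, (h2 e x hx).2, (h2' e x hx).2]
      ring
    · intro x y hxy
      rw [hd, hd, h3 x y hxy, h3' x y hxy]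
    · intro x
      rw [hd, mul_add, ← h4 x, ← h4' x, ← Finset.sum_add_distrib]
      exact Finset.sum_congr rfl fun y _ => hv y
  smul_mem' := by
    rintro c ⟨u, w⟩ ⟨φ, p, h1, h2, h3, h4⟩
    have hv : ∀ y, Γ.endValue (fun e x => c * φ e x) y = c * Γ.endValue φ y := by
      rintro ⟨b, _ | _⟩ <;> rfl
    have hd : ∀ y, Γ.endDeriv (fun e x => c * p e x) y = c * Γ.endDeriv p y := by
      rintro ⟨b, _ | _⟩ <;> simp [endDeriv]
    refine ⟨fun e x => c * φ e x, fun e x => c * p e x, fun e => ?_,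
      fun e x hx => ⟨?_, ?_⟩, ?_, ?_⟩
    · filter_upwards [Lp.coeFn_smul c (u e), h1 e] with t ht ht1
      have : ((c • u) e : ℝ → ℂ) t = c * (u e : ℝ → ℂ) t := ht
      exact this.trans (by rw [ht1])
    · exact (h2 e x hx).1.const_mul c
    · have : ∫ t in (0 : ℝ)..x, ((c • w e :
          Lp ℂ 2 (volume.restrict (Set.Ioc 0 (Γ.length e)))) : ℝ → ℂ) t
          = c * ∫ t in (0 : ℝ)..x, (w e : ℝ → ℂ) t := by
        rw [← intervalIntegral.integral_const_mul]
        exact intervalIntegral.integral_congr_ae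
          (Γ.ae_Ioc_of_ae e hx (Lp.coeFn_smul c (w e)))
      change c * p e x = c * p e 0 - ∫ t in (0 : ℝ)..x, ((c • w e :
          Lp ℂ 2 (volume.restrict (Set.Ioc 0 (Γ.length e)))) : ℝ → ℂ) t
      rw [this, (h2 e x hx).2]
      ring
    · intro x y hxy
      rw [hd, hd, h3 x y hxy]
    · intro x
      rw [hd, mul_left_comm, ← h4 x, Finset.mul_sum]
      exact Finset.sum_congr rfl fun y _ => hv y

/-- The space `{u : -u'' = μ u}` of the `δ'` Laplacian. -/
noncomputable def deltaPrimeEigenspace [Fintype E] (Γ : MetricGraph V E) (α : V → ℝ) (μ : ℝ) :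
    Submodule ℂ Γ.L2 :=
  (Γ.deltaPrimeLaplacianGraph α).comap (LinearMap.prod LinearMap.id ((μ : ℂ) • LinearMap.id))

/-- The sum of the eigenspaces for the eigenvalues up to `r`. Eigenspaces for different eigenvalues
are independent, so its dimension is the number of eigenvalues `≤ r`, counted with multiplicity. -/
noncomputable def deltaPrimeSpectralSpace [Fintype E] (Γ : MetricGraph V E) (α : V → ℝ) (r : ℝ) :
    Submodule ℂ Γ.L2 :=
  ⨆ μ : ℝ, ⨆ _ : μ ≤ r, Γ.deltaPrimeEigenspace α μ

/-- The `n`-th eigenvalue `λₙ(Γ^δ')`, `n = 1, 2, …`, in nondecreasing order and counted with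
multiplicity: the least `r` such that at least `n` eigenvalues are `≤ r`. -/
noncomputable def deltaPrimeEigenvalue [Fintype E] (Γ : MetricGraph V E) (α : V → ℝ) (n : ℕ) :
    EReal :=
  ⨅ r : ℝ, ⨅ _ : (n : Cardinal) ≤ Module.rank ℂ (Γ.deltaPrimeSpectralSpace α r), (r : EReal)

end MetricGraph

/-! On the span of the eigenfunctions with eigenvalue at most `r`, Green's identity and
orthogonality give `‖u'‖² + ∑ α_v |∂u(v)|² ≤ r ‖u‖²` (`energy_le_of_mem_iSup_eigenReps`). Let `W`
contain every vertex of negative strength. If `∂u` vanishes on `W`, the vertex sum is nonnegative;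
if `u` also vanishes at the midpoints of `q e` equal parts of each edge, Wirtinger's inequality
gives `‖u'‖² ≥ s ‖u‖²` edge by edge for every `s` with `0 ≤ s < (q e π / ℓ_e)²`. When `r` is below
all these thresholds, `u = 0`, so these `|W| + ∑ q e` functionals bound the number of eigenvalues up
to `r` (`rank_deltaPrimeSpectralSpace_le`).

Choosing `q = m + 1` on the `j - 1` longest edges and `q = m` on the others gives
`le_deltaPrimeEigenvalue`. Case (a) takes `W = ∅`, case (b) takes all vertices; what remains is
arithmetic with `t = (|V| + 1) / |E|`. -/

/-! ### Wirtinger inequalities on an interval -/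

/-- A Picone-type inequality: a solution `G` of the Riccati equation `G' = -κ² - G²` bounds the
energy of `f` from below by boundary terms. -/
lemma riccati_boundary_le_integral {f p : ℝ → ℂ} {G : ℝ → ℝ} {a b κ : ℝ} (hab : a ≤ b)
    (hf : ∀ x ∈ Set.Icc a b, HasDerivWithinAt f (p x) (Set.Icc a b) x)
    (hp : ContinuousOn p (Set.Icc a b))
    (hG : ∀ x ∈ Set.Icc a b, HasDerivAt G (-κ ^ 2 - G x ^ 2) x) :
    G b * ‖f b‖ ^ 2 - G a * ‖f a‖ ^ 2 ≤ ∫ x in a..b, (‖p x‖ ^ 2 - κ ^ 2 * ‖f x‖ ^ 2) := by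
  have hfc : ContinuousOn f (Set.Icc a b) := fun x hx => (hf x hx).continuousWithinAt
  have hGc : ContinuousOn G (Set.Icc a b) := fun x hx =>
    (hG x hx).continuousAt.continuousWithinAt
  refine intervalIntegral.sub_le_integral_of_hasDeriv_right_of_le (g := fun x => G x * ‖f x‖ ^ 2)
    (g' := fun x => (-κ ^ 2 - G x ^ 2) * ‖f x‖ ^ 2 + G x * (2 * inner ℝ (f x) (p x))) hab
    (hGc.mul (hfc.norm.pow 2)) (fun x hx => ?_) ?_ (fun x hx => ?_)
  · have h1 : HasDerivAt f (p x) x :=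
      (hf x (Set.Ioo_subset_Icc_self hx)).hasDerivAt (Icc_mem_nhds hx.1 hx.2)
    exact ((hG x (Set.Ioo_subset_Icc_self hx)).mul h1.norm_sq).hasDerivWithinAt
  · exact ((hp.norm.pow 2).sub ((hfc.norm.pow 2).const_mul _)).integrableOn_compact isCompact_Icc
  -- Expanding `‖p - G f‖² ≥ 0` bounds the derivative of `G ‖f‖²` by the integrand.
  · have h := sq_nonneg ‖p x - G x • f x‖
    rw [norm_sub_sq_real, norm_smul, inner_smul_right, mul_pow, Real.norm_eq_abs, sq_abs,
      real_inner_comm] at h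
    linarith

/-- Wirtinger's inequality on an interval, for a function vanishing at one endpoint; `d` is the
other endpoint. -/
lemma integral_energy_nonneg_of_eq_zero_endpoint {f p : ℝ → ℂ} {a b d κ : ℝ} (hab : a ≤ b)
    (hf : ∀ x ∈ Set.Icc a b, HasDerivWithinAt f (p x) (Set.Icc a b) x)
    (hp : ContinuousOn p (Set.Icc a b)) (hκ : 0 ≤ κ) (hκab : κ * (b - a) < Real.pi / 2)
    (hd : d = b ∧ f a = 0 ∨ d = a ∧ f b = 0) :
    0 ≤ ∫ x in a..b, (‖p x‖ ^ 2 - κ ^ 2 * ‖f x‖ ^ 2) := by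
  have hd' : d ∈ Set.Icc a b := by
    rcases hd with ⟨rfl, -⟩ | ⟨rfl, -⟩ <;> simp [hab]
  -- This Riccati solution vanishes at `d`, while `f` vanishes at the other endpoint, so both
  -- boundary terms are zero. The bound on `κ (b - a)` keeps the tangent away from its poles.
  have key := riccati_boundary_le_integral (G := fun x => -κ * Real.tan (κ * (x - d)))
    (κ := κ) hab hf hp fun x hx => by
      have hlt : |κ * (x - d)| < Real.pi / 2 := by
        rw [abs_mul, abs_of_nonneg hκ]
        refine lt_of_le_of_lt (mul_le_mul_of_nonneg_left ?_ hκ) hκab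
        rw [abs_le]
        constructor <;> linarith [hx.1, hx.2, hd'.1, hd'.2]
      have hcos : Real.cos (κ * (x - d)) ≠ 0 :=
        (Real.cos_pos_of_mem_Ioo (abs_lt.mp hlt)).ne'
      have h1 : HasDerivAt (fun x => κ * (x - d)) κ x := by
        simpa using ((hasDerivAt_id x).sub_const d).const_mul κ
      have h2 := ((Real.hasDerivAt_tan hcos).comp x h1).const_mul (-κ)
      refine h2.congr_deriv ?_
      have h3 := Real.sin_sq_add_cos_sq (κ * (x - d))
      rw [Real.tan_eq_sin_div_cos]
      field_simp
      linear_combination κ ^ 2 * h3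
  rcases hd with ⟨rfl, h0⟩ | ⟨rfl, h0⟩ <;> simpa [h0] using key

/-- If `f` vanishes at the midpoints of the `q` equal parts of `[0, ℓ]`, then
`κ² ∫ |f|² ≤ ∫ |f'|²` for all `κ < qπ/ℓ`. -/
lemma integral_energy_nonneg_of_eq_zero_midpoints {f p : ℝ → ℂ} {ℓ κ : ℝ} {q : ℕ} (hℓ : 0 < ℓ)
    (hq : 0 < q) (hf : ∀ x ∈ Set.Icc 0 ℓ, HasDerivWithinAt f (p x) (Set.Icc 0 ℓ) x)
    (hp : ContinuousOn p (Set.Icc 0 ℓ)) (hκ : 0 ≤ κ) (hκq : κ < q * Real.pi / ℓ)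
    (h0 : ∀ i < q, f ((2 * i + 1) * (ℓ / (2 * q))) = 0) :
    0 ≤ ∫ x in (0 : ℝ)..ℓ, (‖p x‖ ^ 2 - κ ^ 2 * ‖f x‖ ^ 2) := by
  have hq' : (0 : ℝ) < q := by exact_mod_cast hq
  -- Half the length of a part: each of the `2q` intervals of length `h` has a midpoint, hence a
  -- zero of `f`, at its right end (even index) or left end (odd index), and `κ h < π / 2`.
  set h := ℓ / (2 * q) with hh
  have hh0 : 0 < h := by positivity
  have hlast : ((2 * q : ℕ) : ℝ) * h = ℓ := by rw [hh]; push_cast; field_simp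
  have hsub : ∀ i < 2 * q, Set.Icc ((i : ℝ) * h) ((i + 1 : ℕ) * h) ⊆ Set.Icc 0 ℓ := fun i hi =>
    Set.Icc_subset_Icc (by positivity) (by
      rw [← hlast]; exact mul_le_mul_of_nonneg_right (by exact_mod_cast hi) hh0.le)
  have hle : ∀ i : ℕ, (i : ℝ) * h ≤ (i + 1 : ℕ) * h := fun i =>
    mul_le_mul_of_nonneg_right (by push_cast; linarith) hh0.le
  have hfc : ContinuousOn f (Set.Icc 0 ℓ) := fun x hx => (hf x hx).continuousWithinAt
  have hcont : ContinuousOn (fun x => ‖p x‖ ^ 2 - κ ^ 2 * ‖f x‖ ^ 2) (Set.Icc 0 ℓ) :=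
    (hp.norm.pow 2).sub ((hfc.norm.pow 2).const_mul _)
  have hsum := intervalIntegral.sum_integral_adjacent_intervals (n := 2 * q) (μ := volume)
    (a := fun i : ℕ => (i : ℝ) * h) (f := fun x => ‖p x‖ ^ 2 - κ ^ 2 * ‖f x‖ ^ 2) fun i hi =>
      (hcont.mono (by rw [Set.uIcc_of_le (hle i)]; exact hsub i hi)).intervalIntegrable
  rw [hlast] at hsum
  simp only [Nat.cast_zero, zero_mul] at hsum
  rw [← hsum]
  refine Finset.sum_nonneg fun i hi => ?_
  have hi := Finset.mem_range.mp hi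
  have hκh : κ * ((i + 1 : ℕ) * h - i * h) < Real.pi / 2 := by
    have h1 : κ * h < q * Real.pi / ℓ * h := mul_lt_mul_of_pos_right hκq hh0
    have h2 : q * Real.pi / ℓ * h = Real.pi / 2 := by rw [hh]; field_simp
    push_cast
    linarith
  obtain ⟨t, ht | ht⟩ := Nat.even_or_odd' i
  · refine integral_energy_nonneg_of_eq_zero_endpoint (d := i * h) (hle i)
      (fun x hx => (hf x (hsub i hi hx)).mono (hsub i hi)) (hp.mono (hsub i hi)) hκ hκh
      (Or.inr ⟨rfl, ?_⟩)
    have := h0 t (by omega)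
    rw [ht]; push_cast; exact this
  · refine integral_energy_nonneg_of_eq_zero_endpoint (d := (i + 1 : ℕ) * h) (hle i)
      (fun x hx => (hf x (hsub i hi hx)).mono (hsub i hi)) (hp.mono (hsub i hi)) hκ hκh
      (Or.inl ⟨rfl, ?_⟩)
    have := h0 t (by omega)
    rw [ht]; push_cast; exact this


/-! ### Dimension bound by separating functionals -/

/-- Functionals that separate the image `f(R)` bound its dimension. -/
lemma rank_map_le_card_of_forall_eq_zero {A B ι : Type*} [AddCommGroup A] [Module ℂ A]
    [AddCommGroup B] [Module ℂ B] [Fintype ι] (R : Submodule ℂ A) (f : A →ₗ[ℂ] B)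
    (T : A →ₗ[ℂ] (ι → ℂ)) (h : ∀ z ∈ R, T z = 0 → f z = 0) :
    Module.rank ℂ (R.map f) ≤ Fintype.card ι := by
  -- On `R`, `f` factors through the range of `T`, which is finite-dimensional even if `R` is not.
  have hker : LinearMap.ker (T.domRestrict R) ≤ LinearMap.ker (f.domRestrict R) := fun z hz =>
    h z z.2 hz
  let g := ((LinearMap.ker (T.domRestrict R)).liftQ (f.domRestrict R) hker).comp
    (T.domRestrict R).quotKerEquivRange.symm.toLinearMap
  have hle : R.map f ≤ LinearMap.range g := by
    rintro _ ⟨z, hz, rfl⟩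
    refine ⟨(T.domRestrict R).quotKerEquivRange (Submodule.Quotient.mk ⟨z, hz⟩), ?_⟩
    simp only [g, LinearMap.comp_apply, LinearEquiv.coe_coe, LinearEquiv.symm_apply_apply]
    rfl
  have hfin : Module.finrank ℂ (R.map f) ≤ Fintype.card ι :=
    calc Module.finrank ℂ (R.map f) ≤ Module.finrank ℂ (LinearMap.range g) :=
          Submodule.finrank_mono hle
      _ ≤ Module.finrank ℂ (LinearMap.range (T.domRestrict R)) := LinearMap.finrank_range_le g
      _ ≤ Module.finrank ℂ (ι → ℂ) := Submodule.finrank_le _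
      _ = Fintype.card ι := Module.finrank_fintype_fun_eq_card ℂ
  have := Submodule.finiteDimensional_of_le hle
  rw [← Module.finrank_eq_rank]
  exact_mod_cast hfin

/-! ### Smooth representatives of eigenfunctions -/

namespace MetricGraph

variable {V E : Type*}

/-- The derivative at an endpoint, as a linear functional. -/
def endDerivₗ (Γ : MetricGraph V E) (x : E × Bool) : (E → ℝ → ℂ) →ₗ[ℂ] ℂ where
  toFun p := Γ.endDeriv p x
  map_add' p p' := by
    obtain ⟨e, _ | _⟩ := x <;> (simp [endDeriv]; try ring)
  map_smul' c p := by
    obtain ⟨e, _ | _⟩ := x <;> simp [endDeriv]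

/-- The value at an endpoint, as a linear functional. -/
def endValueₗ (Γ : MetricGraph V E) (x : E × Bool) : (E → ℝ → ℂ) →ₗ[ℂ] ℂ where
  toFun p := Γ.endValue p x
  map_add' p p' := by obtain ⟨e, _ | _⟩ := x <;> rfl
  map_smul' c p := by obtain ⟨e, _ | _⟩ := x <;> rfl

lemma DeltaPrimeCondition.add [Fintype E] {Γ : MetricGraph V E} {α : V → ℝ}
    {φ p φ' p' : E → ℝ → ℂ} (h : Γ.DeltaPrimeCondition α φ p)
    (h' : Γ.DeltaPrimeCondition α φ' p') : Γ.DeltaPrimeCondition α (φ + φ') (p + p') := by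
  have hv : ∀ y, Γ.endValue (φ + φ') y = Γ.endValue φ y + Γ.endValue φ' y := fun y =>
    (Γ.endValueₗ y).map_add φ φ'
  have hd : ∀ y, Γ.endDeriv (p + p') y = Γ.endDeriv p y + Γ.endDeriv p' y := fun y =>
    (Γ.endDerivₗ y).map_add p p'
  refine ⟨fun x y hxy => by rw [hd, hd, h.1 x y hxy, h'.1 x y hxy], fun x => ?_⟩
  simp only [hv, hd, Finset.sum_add_distrib, h.2, h'.2, mul_add]

lemma DeltaPrimeCondition.smul [Fintype E] {Γ : MetricGraph V E} {α : V → ℝ}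
    {φ p : E → ℝ → ℂ} (h : Γ.DeltaPrimeCondition α φ p) (c : ℂ) :
    Γ.DeltaPrimeCondition α (c • φ) (c • p) := by
  have hv : ∀ y, Γ.endValue (c • φ) y = c * Γ.endValue φ y := fun y =>
    (Γ.endValueₗ y).map_smul c φ
  have hd : ∀ y, Γ.endDeriv (c • p) y = c * Γ.endDeriv p y := fun y =>
    (Γ.endDerivₗ y).map_smul c p
  refine ⟨fun x y hxy => by rw [hd, hd, h.1 x y hxy], fun x => ?_⟩
  simp only [hv, hd, ← Finset.mul_sum, h.2]
  ring

lemma DeltaPrimeCondition.zero [Fintype E] (Γ : MetricGraph V E) (α : V → ℝ) :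
    Γ.DeltaPrimeCondition α 0 0 := by
  have hv : ∀ y, Γ.endValue 0 y = 0 := fun y => (Γ.endValueₗ y).map_zero
  have hd : ∀ y, Γ.endDeriv 0 y = 0 := fun y => (Γ.endDerivₗ y).map_zero
  exact ⟨fun x y _ => by rw [hd, hd], fun x => by simp [hv, hd]⟩

/-- Quadruples consisting of two elements of `L²(Γ)` and two functions. -/
abbrev Rep [Fintype E] (Γ : MetricGraph V E) : Type _ :=
  (Γ.L2 × Γ.L2) × (E → ℝ → ℂ) × (E → ℝ → ℂ)

/-- The quadruples `((u, u'), (φ, φ'))` for which `φ` is a `C¹` representative of `u` satisfying the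
`δ'` conditions. -/
def c1Reps [Fintype E] (Γ : MetricGraph V E) (α : V → ℝ) : Submodule ℂ Γ.Rep where
  carrier := {z |
    (∀ e, (z.1.1 e : ℝ → ℂ) =ᵐ[volume.restrict (Set.Ioc 0 (Γ.length e))] z.2.1 e) ∧
    (∀ e, (z.1.2 e : ℝ → ℂ) =ᵐ[volume.restrict (Set.Ioc 0 (Γ.length e))] z.2.2 e) ∧
    (∀ e, ∀ x ∈ Set.Icc 0 (Γ.length e),
      HasDerivWithinAt (z.2.1 e) (z.2.2 e x) (Set.Icc 0 (Γ.length e)) x) ∧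
    (∀ e, ContinuousOn (z.2.2 e) (Set.Icc 0 (Γ.length e))) ∧
    Γ.DeltaPrimeCondition α z.2.1 z.2.2}
  zero_mem' := ⟨fun _ => Lp.coeFn_zero _ _ _, fun _ => Lp.coeFn_zero _ _ _,
    fun _ _ _ => hasDerivWithinAt_const _ _ _, fun _ => continuousOn_const, .zero Γ α⟩
  add_mem' := by
    rintro z z' ⟨h1, h2, h3, h4, h5⟩ ⟨h1', h2', h3', h4', h5'⟩
    exact ⟨fun e => (Lp.coeFn_add (z.1.1 e) (z'.1.1 e)).trans ((h1 e).add (h1' e)),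
      fun e => (Lp.coeFn_add (z.1.2 e) (z'.1.2 e)).trans ((h2 e).add (h2' e)),
      fun e x hx => (h3 e x hx).add (h3' e x hx), fun e => (h4 e).add (h4' e), h5.add h5'⟩
  smul_mem' := by
    rintro c z ⟨h1, h2, h3, h4, h5⟩
    exact ⟨fun e => (Lp.coeFn_smul c (z.1.1 e)).trans ((h1 e).const_smul c),
      fun e => (Lp.coeFn_smul c (z.1.2 e)).trans ((h2 e).const_smul c),
      fun e x hx => (h3 e x hx).const_smul c, fun e => (h4 e).const_smul c, h5.smul c⟩

/-- The quadruples `((u, u'), (φ, φ'))` in `c1Reps` with `-φ'' = μ φ`. -/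
noncomputable def eigenReps [Fintype E] (Γ : MetricGraph V E) (α : V → ℝ) (μ : ℝ) : Submodule ℂ Γ.Rep :=
  Γ.c1Reps α ⊓
  { carrier := {z | ∀ e, ∀ x ∈ Set.Icc 0 (Γ.length e),
      HasDerivWithinAt (z.2.2 e) (-(μ * z.2.1 e x)) (Set.Icc 0 (Γ.length e)) x}
    zero_mem' := fun e x _ => by
      refine (hasDerivWithinAt_const x (Set.Icc 0 (Γ.length e)) (0 : ℂ)).congr_deriv ?_
      change 0 = -((μ : ℂ) * 0)
      simp
    add_mem' := fun {z z'} h h' e x hx => by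
      refine ((h e x hx).add (h' e x hx)).congr_deriv ?_
      change _ = -(μ * (z.2.1 e x + z'.2.1 e x))
      ring
    smul_mem' := fun c z h e x hx => by
      refine ((h e x hx).const_smul c).congr_deriv ?_
      change c * _ = -(μ * (c * z.2.1 e x))
      ring }

/-- Every eigenfunction has a `C²` representative. -/
lemma deltaPrimeEigenspace_le_map_eigenReps [Fintype E] (Γ : MetricGraph V E) (α : V → ℝ) (μ : ℝ) :
    Γ.deltaPrimeEigenspace α μ ≤
      (Γ.eigenReps α μ).map (LinearMap.fst ℂ _ _ ∘ₗ LinearMap.fst ℂ _ _) := by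
  rintro u ⟨φ, p, hu, hφ, hδ⟩
  change ∀ e, (u e : ℝ → ℂ) =ᵐ[_] φ e at hu
  have hφc : ∀ e, ContinuousOn (φ e) (Set.Icc 0 (Γ.length e)) := fun e x hx =>
    (hφ e x hx).1.continuousWithinAt
  -- Replacing the `L²` class of `-φ''` by the continuous function `μ φ` lets the fundamental
  -- theorem of calculus differentiate `p` at every point.
  have hp : ∀ e, ∀ x ∈ Set.Icc 0 (Γ.length e),
      p e x = p e 0 - ∫ t in (0 : ℝ)..x, (μ : ℂ) * φ e t := by
    intro e x hx
    rw [(hφ e x hx).2]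
    congr 1
    refine intervalIntegral.integral_congr_ae (Γ.ae_Ioc_of_ae e hx ?_)
    exact (Lp.coeFn_smul (μ : ℂ) (u e)).trans ((hu e).const_smul (μ : ℂ))
  have hp' : ∀ e, ∀ x ∈ Set.Icc 0 (Γ.length e),
      HasDerivWithinAt (p e) (-(μ * φ e x)) (Set.Icc 0 (Γ.length e)) x := by
    intro e x hx
    have hc : ContinuousOn (fun t => (μ : ℂ) * φ e t) (Set.Icc 0 (Γ.length e)) :=
      (hφc e).const_mul _
    have : Fact (x ∈ Set.Icc 0 (Γ.length e)) := ⟨hx⟩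
    have h := intervalIntegral.integral_hasDerivWithinAt_right (a := 0)
      (s := Set.Icc 0 (Γ.length e)) (t := Set.Icc 0 (Γ.length e)) (b := x)
      ((hc.mono (by rw [Set.uIcc_of_le hx.1]; exact Set.Icc_subset_Icc_right hx.2)
        ).intervalIntegrable)
      (hc.stronglyMeasurableAtFilter_nhdsWithin measurableSet_Icc x) (hc x hx)
    exact (h.const_sub (p e 0)).congr (hp e) (hp e x hx)
  have hpc : ∀ e, ContinuousOn (p e) (Set.Icc 0 (Γ.length e)) := fun e x hx =>
    (hp' e x hx).continuousWithinAt
  have hmem : ∀ e, MemLp (p e) 2 (volume.restrict (Set.Ioc 0 (Γ.length e))) := fun e =>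
    let ⟨C, hC⟩ := isCompact_Icc.exists_bound_of_continuousOn (hpc e)
    MemLp.of_bound (((hpc e).mono Set.Ioc_subset_Icc_self).aestronglyMeasurable
      measurableSet_Ioc) C ((ae_restrict_mem measurableSet_Ioc).mono fun x hx =>
        hC x (Set.Ioc_subset_Icc_self hx))
  exact ⟨((u, WithLp.toLp 2 fun e => (hmem e).toLp), (φ, p)),
    ⟨⟨hu, fun e => (hmem e).coeFn_toLp, fun e x hx => (hφ e x hx).1, hpc, hδ⟩, hp'⟩, rfl⟩

/-! ### Green's identity and the quadratic form -/

lemma inner_eq_sum_integral [Fintype E] (Γ : MetricGraph V E) {u v : Γ.L2} {f g : E → ℝ → ℂ}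
    (hu : ∀ e, (u e : ℝ → ℂ) =ᵐ[volume.restrict (Set.Ioc 0 (Γ.length e))] f e)
    (hv : ∀ e, (v e : ℝ → ℂ) =ᵐ[volume.restrict (Set.Ioc 0 (Γ.length e))] g e) :
    inner ℂ u v = ∑ e, ∫ x in (0 : ℝ)..Γ.length e, inner ℂ (f e x) (g e x) := by
  rw [PiLp.inner_apply]
  refine Finset.sum_congr rfl fun e _ => ?_
  rw [L2.inner_def, intervalIntegral.integral_of_le (Γ.length_pos e).le]
  refine integral_congr_ae ?_
  filter_upwards [hu e, hv e] with x h1 h2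
  rw [h1, h2]

/-- An endpoint in each vertex. -/
noncomputable def endpoint (Γ : MetricGraph V E) : V → E × Bool :=
  Function.surjInv Γ.vertex_surjective

lemma vertex_endpoint (Γ : MetricGraph V E) (v : V) : Γ.vertex (Γ.endpoint v) = v :=
  Function.surjInv_eq _ v

/-- Within a vertex the derivative is constant and factors out of the sum, leaving the total of the
values, which is `α v` times the derivative. The boundary form thus has the sign of `α v` at each
vertex. -/
lemma sum_inner_endValue_endDeriv [Fintype V] [Fintype E] (Γ : MetricGraph V E) {α : V → ℝ}
    {φ p φ' p' : E → ℝ → ℂ} (h : Γ.DeltaPrimeCondition α φ p)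
    (h' : Γ.DeltaPrimeCondition α φ' p') :
    ∑ x, inner ℂ (Γ.endValue φ x) (Γ.endDeriv p' x) =
      ∑ v, α v * inner ℂ (Γ.endDeriv p (Γ.endpoint v)) (Γ.endDeriv p' (Γ.endpoint v)) := by
  classical
  rw [← Finset.sum_fiberwise (g := Γ.vertex)]
  refine Finset.sum_congr rfl fun v _ => ?_
  have h1 : ∀ x ∈ Finset.univ.filter (fun x => Γ.vertex x = v),
      inner ℂ (Γ.endValue φ x) (Γ.endDeriv p' x) =
        inner ℂ (Γ.endValue φ x) (Γ.endDeriv p' (Γ.endpoint v)) := fun x hx => by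
    rw [h'.1 x (Γ.endpoint v) (by rw [vertex_endpoint, (Finset.mem_filter.mp hx).2])]
  have h2 := h.2 (Γ.endpoint v)
  rw [vertex_endpoint] at h2
  rw [Finset.sum_congr rfl h1, ← sum_inner]
  have h3 : ∑ x with Γ.vertex x = v, Γ.endValue φ x = α v * Γ.endDeriv p (Γ.endpoint v) := by
    rw [← h2]
  rw [h3, ← smul_eq_mul, inner_smul_left, Complex.conj_ofReal]

/-- Green's identity for a `C¹` function and an eigenfunction, both satisfying the `δ'`
conditions. -/
lemma inner_deriv_add_boundary_eq [Fintype V] [Fintype E] (Γ : MetricGraph V E) {α : V → ℝ} {μ : ℝ}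
    {z z' : Γ.Rep} (hz : z ∈ Γ.c1Reps α) (hz' : z' ∈ Γ.eigenReps α μ) :
    inner ℂ z.1.2 z'.1.2 + ∑ v, α v * inner ℂ (Γ.endDeriv z.2.2 (Γ.endpoint v))
      (Γ.endDeriv z'.2.2 (Γ.endpoint v)) = μ * inner ℂ z.1.1 z'.1.1 := by
  obtain ⟨h1, h2, h3, h4, h5⟩ := hz
  obtain ⟨⟨h1', h2', h3', h4', h5'⟩, h6'⟩ := hz'
  rw [Γ.inner_eq_sum_integral h2 h2', Γ.inner_eq_sum_integral h1 h1',
    ← Γ.sum_inner_endValue_endDeriv h5 h5', Fintype.sum_prod_type, ← Finset.sum_add_distrib,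
    Finset.mul_sum]
  refine Finset.sum_congr rfl fun e _ => ?_
  have hℓ := (Γ.length_pos e).le
  have hc : ContinuousOn (z.2.1 e) (Set.Icc 0 (Γ.length e)) := fun x hx =>
    (h3 e x hx).continuousWithinAt
  have hc' : ContinuousOn (z'.2.1 e) (Set.Icc 0 (Γ.length e)) := fun x hx =>
    (h3' e x hx).continuousWithinAt
  have hi1 : IntervalIntegrable (fun x => inner ℂ (z.2.1 e x) (-(μ * z'.2.1 e x))) volume 0
      (Γ.length e) := ContinuousOn.intervalIntegrable (by
    rw [Set.uIcc_of_le hℓ]; exact hc.inner (𝕜 := ℂ) (hc'.const_mul _).neg)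
  have hi2 : IntervalIntegrable (fun x => inner ℂ (z.2.2 e x) (z'.2.2 e x)) volume 0
      (Γ.length e) := ContinuousOn.intervalIntegrable (by
    rw [Set.uIcc_of_le hℓ]; exact (h4 e).inner (𝕜 := ℂ) (h4' e))
  have key := intervalIntegral.integral_eq_sub_of_hasDerivAt_of_le
    (f := fun x => inner ℂ (z.2.1 e x) (z'.2.2 e x))
    (f' := fun x => inner ℂ (z.2.1 e x) (-(μ * z'.2.1 e x)) + inner ℂ (z.2.2 e x) (z'.2.2 e x))
    hℓ (hc.inner (𝕜 := ℂ) (h4' e)) (fun x hx => by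
      have hn := Icc_mem_nhds hx.1 hx.2
      have hx' := Set.Ioo_subset_Icc_self hx
      exact ((h3 e x hx').hasDerivAt hn).inner ℂ ((h6' e x hx').hasDerivAt hn)) (hi1.add hi2)
  rw [intervalIntegral.integral_add hi1 hi2] at key
  have h7 : ∀ x, inner ℂ (z.2.1 e x) (-(μ * z'.2.1 e x)) =
      -(μ : ℂ) * inner ℂ (z.2.1 e x) (z'.2.1 e x) := fun x => by
    rw [inner_neg_right, ← smul_eq_mul, inner_smul_right, neg_mul]
  simp only [h7, intervalIntegral.integral_const_mul] at key
  simp only [Fintype.sum_bool, endValue, endDeriv, inner_neg_right]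
  linear_combination key

/-- The left side of Green's identity is Hermitian, so exchanging the two eigenfunctions multiplies
the same inner product by `μ` instead of `μ'`. -/
lemma inner_eq_zero_of_mem_eigenReps [Fintype V] [Fintype E] (Γ : MetricGraph V E) {α : V → ℝ}
    {μ μ' : ℝ} (hμ : μ ≠ μ') {z z' : Γ.Rep} (hz : z ∈ Γ.eigenReps α μ)
    (hz' : z' ∈ Γ.eigenReps α μ') : inner ℂ z.1.1 z'.1.1 = 0 := by
  have h1 := Γ.inner_deriv_add_boundary_eq hz.1 hz'
  have h2 := congrArg (starRingEnd ℂ) (Γ.inner_deriv_add_boundary_eq hz'.1 hz)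
  simp only [map_add, map_sum, map_mul, inner_conj_symm, Complex.conj_ofReal] at h2
  have h3 : ((μ : ℂ) - μ') * inner ℂ z.1.1 z'.1.1 = 0 := by
    rw [sub_mul, ← h1, ← h2, sub_self]
  exact (mul_eq_zero.mp h3).resolve_left (sub_ne_zero.mpr (by exact_mod_cast hμ))

/-- The quadratic form of the `δ'` Laplacian is at most `r‖u‖²` on the span of the eigenfunctions
for the eigenvalues up to `r`. -/
lemma energy_le_of_mem_iSup_eigenReps [Fintype V] [Fintype E] (Γ : MetricGraph V E) {α : V → ℝ}
    {r : ℝ} {z : Γ.Rep} (hz : z ∈ ⨆ μ : Set.Iic r, Γ.eigenReps α μ) :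
    z ∈ Γ.c1Reps α ∧
    ‖z.1.2‖ ^ 2 + ∑ v, α v * ‖Γ.endDeriv z.2.2 (Γ.endpoint v)‖ ^ 2 ≤ r * ‖z.1.1‖ ^ 2 := by
  have hz1 : z ∈ Γ.c1Reps α := (iSup_le fun _ => inf_le_left :
    ⨆ μ : Set.Iic r, Γ.eigenReps α μ ≤ Γ.c1Reps α) hz
  refine ⟨hz1, ?_⟩
  obtain ⟨f, hf, hsum⟩ := (Submodule.mem_iSup_iff_exists_finsupp _ z).mp hz
  have hU : ∑ i ∈ f.support, (f i).1.1 = z.1.1 := by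
    rw [← hsum, Finsupp.sum, Prod.fst_sum, Prod.fst_sum]
  have hP : ∑ i ∈ f.support, (f i).1.2 = z.1.2 := by
    rw [← hsum, Finsupp.sum, Prod.fst_sum, Prod.snd_sum]
  have hD : ∀ x, ∑ i ∈ f.support, Γ.endDeriv (f i).2.2 x = Γ.endDeriv z.2.2 x := fun x => by
    have h := map_sum (Γ.endDerivₗ x) (fun i => (f i).2.2) f.support
    rw [← hsum, Finsupp.sum, Prod.snd_sum, Prod.snd_sum]
    exact h.symm
  have horth : ∀ i ∈ f.support, inner ℂ z.1.1 (f i).1.1 = ((‖(f i).1.1‖ ^ 2 : ℝ) : ℂ) := by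
    intro i hi
    rw [← hU, sum_inner, Finset.sum_eq_single i]
    · rw [inner_self_eq_norm_sq_to_K]; push_cast; rfl
    · intro j _ hji
      exact Γ.inner_eq_zero_of_mem_eigenReps (fun h => hji (Subtype.ext h)) (hf j) (hf i)
    · exact fun h => absurd hi h
  -- Green's identity of `z` against each component `f i`, summed: orthogonality turns the form into
  -- `∑ μ_i ‖f i‖²`.
  have hgreen : inner ℂ z.1.2 z.1.2 + ∑ v, α v * inner ℂ (Γ.endDeriv z.2.2 (Γ.endpoint v))
      (Γ.endDeriv z.2.2 (Γ.endpoint v)) =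
      ∑ i ∈ f.support, ((i : ℝ) : ℂ) * ((‖(f i).1.1‖ ^ 2 : ℝ) : ℂ) := by
    have h := Finset.sum_congr rfl fun i (hi : i ∈ f.support) =>
      (Γ.inner_deriv_add_boundary_eq hz1 (hf i)).trans (by rw [horth i hi])
    rw [← h, Finset.sum_add_distrib, ← inner_sum, hP, Finset.sum_comm]
    simp only [← Finset.mul_sum, ← inner_sum, hD]
  have hnorm : ((‖z.1.1‖ ^ 2 : ℝ) : ℂ) = ∑ i ∈ f.support, ((‖(f i).1.1‖ ^ 2 : ℝ) : ℂ) := by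
    rw [← Finset.sum_congr rfl horth, ← inner_sum, hU, inner_self_eq_norm_sq_to_K]
    push_cast; rfl
  simp only [inner_self_eq_norm_sq_to_K, Complex.coe_algebraMap] at hgreen
  norm_cast at hgreen hnorm
  rw [hgreen, hnorm, Finset.mul_sum]
  exact Finset.sum_le_sum fun i _ => mul_le_mul_of_nonneg_right i.2 (sq_nonneg _)

lemma sq_norm_eq_integral [Fintype E] (Γ : MetricGraph V E) {u : Γ.L2} {f : E → ℝ → ℂ} (e : E)
    (hu : (u e : ℝ → ℂ) =ᵐ[volume.restrict (Set.Ioc 0 (Γ.length e))] f e) :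
    ‖u e‖ ^ 2 = ∫ x in (0 : ℝ)..Γ.length e, ‖f e x‖ ^ 2 := by
  have h : (inner ℂ (u e) (u e) : ℂ) =
      ((∫ x in (0 : ℝ)..Γ.length e, ‖f e x‖ ^ 2 : ℝ) : ℂ) := by
    rw [L2.inner_def, intervalIntegral.integral_of_le (Γ.length_pos e).le, ← integral_complex_ofReal]
    refine integral_congr_ae ?_
    filter_upwards [hu] with x h1
    rw [h1, inner_self_eq_norm_sq_to_K]
    push_cast; rfl
  rw [inner_self_eq_norm_sq_to_K] at h
  refine Complex.ofReal_injective ?_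
  rw [Complex.ofReal_pow]
  exact h

/-! ### Counting eigenvalues -/

/-- The number of eigenvalues `≤ r` is at most the number of negative strengths plus the number of
Neumann eigenvalues `≤ r` of the decoupled edges. -/
theorem rank_deltaPrimeSpectralSpace_le [Fintype V] [Fintype E] (Γ : MetricGraph V E)
    {α : V → ℝ} {r : ℝ} (W : Finset V) (hW : ∀ v ∉ W, 0 ≤ α v) (q : E → ℕ) (hq : ∀ e, 0 < q e)
    (hr : ∀ e, r < (q e * Real.pi / Γ.length e) ^ 2) :
    Module.rank ℂ (Γ.deltaPrimeSpectralSpace α r) ≤ ((W.card + ∑ e, q e : ℕ) : Cardinal) := by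
  classical
  have hS : Γ.deltaPrimeSpectralSpace α r ≤ (⨆ μ : Set.Iic r, Γ.eigenReps α μ).map
      (LinearMap.fst ℂ _ _ ∘ₗ LinearMap.fst ℂ _ _) := by
    rw [Submodule.map_iSup]
    exact iSup₂_le fun μ hμ => (Γ.deltaPrimeEigenspace_le_map_eigenReps α μ).trans
      (le_iSup (fun μ : Set.Iic r => (Γ.eigenReps α μ).map
        (LinearMap.fst ℂ _ _ ∘ₗ LinearMap.fst ℂ _ _)) ⟨μ, hμ⟩)
  refine (Submodule.rank_mono hS).trans ?_
  let T : Γ.Rep →ₗ[ℂ] (W ⊕ (Σ e, Fin (q e)) → ℂ) := LinearMap.pi (Sum.elim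
    (fun v => Γ.endDerivₗ (Γ.endpoint v) ∘ₗ LinearMap.snd ℂ _ _ ∘ₗ LinearMap.snd ℂ _ _)
    (fun i => LinearMap.proj ((2 * (i.2 : ℕ) + 1) * (Γ.length i.1 / (2 * q i.1)) : ℝ) ∘ₗ
      LinearMap.proj (φ := fun _ : E => ℝ → ℂ) i.1 ∘ₗ
      LinearMap.fst ℂ _ _ ∘ₗ LinearMap.snd ℂ _ _))
  refine (rank_map_le_card_of_forall_eq_zero _ _ T fun z hz hTz => ?_).trans (by simp)
  change z.1.1 = 0
  obtain ⟨⟨h1, h2, h3, h4, -⟩, hen⟩ := Γ.energy_le_of_mem_iSup_eigenReps hz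
  have hT1 : ∀ v ∈ W, Γ.endDeriv z.2.2 (Γ.endpoint v) = 0 := fun v hv =>
    congrFun hTz (Sum.inl ⟨v, hv⟩)
  have hT2 : ∀ e, ∀ i < q e, z.2.1 e ((2 * i + 1) * (Γ.length e / (2 * q e))) = 0 :=
    fun e i hi => congrFun hTz (Sum.inr ⟨e, ⟨i, hi⟩⟩)
  have hbd : 0 ≤ ∑ v, α v * ‖Γ.endDeriv z.2.2 (Γ.endpoint v)‖ ^ 2 :=
    Finset.sum_nonneg fun v _ => by
      by_cases hv : v ∈ W
      · simp [hT1 v hv]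
      · exact mul_nonneg (hW v hv) (sq_nonneg _)
  have hκ : ∀ e, ∃ s, r < s ∧ s * ‖z.1.1 e‖ ^ 2 ≤ ‖z.1.2 e‖ ^ 2 := by
    intro e
    have hpos : 0 < q e * Real.pi / Γ.length e :=
      div_pos (mul_pos (by exact_mod_cast hq e) Real.pi_pos) (Γ.length_pos e)
    -- `s` exceeds `r` strictly, which later forces `u = 0`, and exceeds `0` so that `κ = √s` makes
    -- sense when `r` is negative.
    obtain ⟨s, hs, hs'⟩ := exists_between (max_lt (hr e) (pow_pos hpos 2))
    have hs0 : 0 ≤ s := (le_max_right _ _).trans hs.le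
    refine ⟨s, (le_max_left _ _).trans_lt hs, ?_⟩
    have h := integral_energy_nonneg_of_eq_zero_midpoints (Γ.length_pos e) (hq e) (h3 e) (h4 e)
      (Real.sqrt_nonneg s) ((Real.sqrt_lt' hpos).mpr hs') (hT2 e)
    have hc : ContinuousOn (z.2.1 e) (Set.Icc 0 (Γ.length e)) := fun x hx =>
      (h3 e x hx).continuousWithinAt
    rw [← Set.uIcc_of_le (Γ.length_pos e).le] at hc
    have h4e := h4 e
    rw [← Set.uIcc_of_le (Γ.length_pos e).le] at h4e
    have hi1 : IntervalIntegrable (fun x => ‖z.2.2 e x‖ ^ 2) volume 0 (Γ.length e) :=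
      (h4e.norm.pow 2).intervalIntegrable
    have hi2 : IntervalIntegrable (fun x => ‖z.2.1 e x‖ ^ 2) volume 0 (Γ.length e) :=
      (hc.norm.pow 2).intervalIntegrable
    rw [intervalIntegral.integral_sub hi1 (hi2.const_mul _), intervalIntegral.integral_const_mul,
      Real.sq_sqrt hs0, ← Γ.sq_norm_eq_integral e (h1 e), ← Γ.sq_norm_eq_integral e (h2 e)] at h
    linarith
  choose s hrs hs using hκ
  -- The edge bounds, the nonnegative vertex sum and the energy bound by `r ‖u‖²` combine here.
  have hle : ∑ e, (s e - r) * ‖z.1.1 e‖ ^ 2 ≤ 0 := by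
    have h5 := Finset.sum_le_sum fun e (_ : e ∈ Finset.univ) => hs e
    rw [← PiLp.norm_sq_eq_of_L2] at h5
    simp only [sub_mul, Finset.sum_sub_distrib, ← Finset.mul_sum, ← PiLp.norm_sq_eq_of_L2]
    linarith
  have hnn : ∀ e ∈ Finset.univ, 0 ≤ (s e - r) * ‖z.1.1 e‖ ^ 2 := fun e _ =>
    mul_nonneg (sub_nonneg.mpr (hrs e).le) (sq_nonneg _)
  have h0 := (Finset.sum_eq_zero_iff_of_nonneg hnn).mp (le_antisymm hle (Finset.sum_nonneg hnn))
  ext1 e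
  have h6 := (mul_eq_zero.mp (h0 e (Finset.mem_univ e))).resolve_left
    (sub_pos.mpr (hrs e)).ne'
  exact norm_eq_zero.mp (pow_eq_zero_iff two_ne_zero |>.mp h6)

end MetricGraph

/-! ### Comparison with decoupled edges -/

namespace MetricGraph

variable {V E : Type*}

/-- Passing to the simple graph only drops loops and merges parallel edges, and a connected simple
graph has at least `|V| - 1` edges. -/
lemma IsConnected.card_vertices_le [Fintype V] [Fintype E] {Γ : MetricGraph V E}
    (h : Γ.IsConnected) : Fintype.card V ≤ Fintype.card E + 1 := by
  classical
  have h1 := SimpleGraph.Connected.card_vert_le_card_edgeSet_add_one h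
  rw [Nat.card_eq_fintype_card] at h1
  refine h1.trans (Nat.add_le_add_right ?_ 1)
  rw [← Nat.card_eq_fintype_card (α := E), ← Set.ncard_univ E, Nat.card_coe_set_eq]
  have h2 : (SimpleGraph.fromRel fun v w => ∃ e, Γ.vertex (e, false) = v ∧
      Γ.vertex (e, true) = w).edgeSet ⊆
      (fun e => s(Γ.vertex (e, false), Γ.vertex (e, true))) '' Set.univ := by
    intro x
    induction x with
    | _ v w =>
      rintro ⟨-, ⟨e, rfl, rfl⟩ | ⟨e, rfl, rfl⟩⟩
      · exact ⟨e, trivial, rfl⟩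
      · exact ⟨e, trivial, Sym2.eq_swap⟩
  exact (Set.ncard_le_ncard h2).trans (Set.ncard_image_le Set.finite_univ)

/-- A lower bound on eigenvalues by those of the decoupled edges: the first `j - 1` edges
contribute `m + 1` eigenvalues each, the others `m`. -/
lemma le_deltaPrimeEigenvalue [Fintype V] [Fintype E] (Γ : MetricGraph V E) {α : V → ℝ}
    (W : Finset V) (hW : ∀ v ∉ W, 0 ≤ α v) (edge : Fin (Fintype.card E) ≃ E) {B : ℝ} {m : ℕ}
    (hm : 1 ≤ m) {j n : ℕ} (hn : W.card + (m * Fintype.card E + (j - 1)) < n)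
    (h₁ : ∀ i, B ≤ ((m + 1) * Real.pi / Γ.length (edge i)) ^ 2)
    (h₂ : ∀ i : Fin (Fintype.card E), j - 1 ≤ (i : ℕ) → B ≤ (m * Real.pi / Γ.length (edge i)) ^ 2) :
    (B : EReal) ≤ Γ.deltaPrimeEigenvalue α n := by
  refine le_iInf₂ fun r hr => EReal.coe_le_coe_iff.mpr ?_
  by_contra! hlt
  -- Indices start at `0`, so the edge of length `ℓ_j` has index `j - 1` and is the first to receive
  -- only `m`.
  let q : E → ℕ := fun e => m + if (edge.symm e : ℕ) < j - 1 then 1 else 0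
  have hrank := Γ.rank_deltaPrimeSpectralSpace_le (r := r) W hW q
    (fun e => by simp only [q]; omega) fun e => by
      refine hlt.trans_le ?_
      have h := h₁ (edge.symm e)
      have h' := h₂ (edge.symm e)
      rw [Equiv.apply_symm_apply] at h h'
      by_cases hi : (edge.symm e : ℕ) < j - 1
      · simpa [q, hi] using h
      · simpa [q, hi] using h' (not_lt.mp hi)
  have hsum : ∑ e, q e ≤ m * Fintype.card E + (j - 1) := by
    simp only [q, Finset.sum_add_distrib, Finset.sum_const, Finset.card_univ, smul_eq_mul]
    rw [mul_comm m]
    refine Nat.add_le_add_left ?_ _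
    rw [Equiv.sum_comp edge.symm (fun i : Fin (Fintype.card E) => if (i : ℕ) < j - 1 then 1 else 0),
      ← Finset.card_filter]
    refine (Finset.card_le_card_of_injOn (t := Finset.range (j - 1)) Fin.val
      (fun i hi => ?_) (fun _ _ _ _ => Fin.ext)).trans (Finset.card_range _).le
    simpa using hi
  have := Nat.cast_le.mp (hr.trans hrank)
  omega

end MetricGraph

/-- The absolute value matters: in case (a) the squared numerators can have negative bases. -/
lemma div_four_mul_sq_le_sq {a b x y : ℝ} (ha : |a| ≤ 2 * b) (hx : 0 < x) (hxy : x ≤ y) :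
    a ^ 2 * Real.pi ^ 2 / (4 * y ^ 2) ≤ (b * Real.pi / x) ^ 2 := by
  have h1 : a ^ 2 ≤ (2 * b) ^ 2 := sq_le_sq' (by linarith [neg_abs_le a]) ((le_abs_self a).trans ha)
  calc a ^ 2 * Real.pi ^ 2 / (4 * y ^ 2) ≤ (2 * b) ^ 2 * Real.pi ^ 2 / (4 * x ^ 2) := by
        gcongr
    _ = (b * Real.pi / x) ^ 2 := by field_simp; ring

theorem theorem4p7 {V E : Type*} [Fintype V] [Fintype E] (Γ : MetricGraph V E)
    (hΓ : Γ.IsConnected) (hE : 2 ≤ Fintype.card E)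
    (α : V → ℝ) (hα : ∀ v, α v ≠ 0)
    (edge : Fin (Fintype.card E) ≃ E) (hedge : Antitone fun i => Γ.length (edge i))
    (k : ℝ)
    (hk : ((∀ v, 0 < α v) ∧ ∃ m : ℕ, 1 ≤ m ∧ k = m) ∨
      ∃ m : ℕ, k - (1 + ((Fintype.card V : ℝ) + 1) / (Fintype.card E : ℝ)) = m)
    (j : ℕ) (hj₁ : 1 ≤ j) (hj : j ≤ Fintype.card E)
    (n : ℕ) (hn : (n : ℝ) = k * (Fintype.card E : ℝ) + j) :
    ((min
      ((2 * (k - (1 + ((Fintype.card V : ℝ) + 1) / (Fintype.card E : ℝ))) + 3) ^ 2 * Real.pi ^ 2 /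
        (4 * Γ.length (edge ⟨0, by omega⟩) ^ 2))
      ((2 * (k - (1 + ((Fintype.card V : ℝ) + 1) / (Fintype.card E : ℝ))) + 1) ^ 2 * Real.pi ^ 2 /
        (4 * Γ.length (edge ⟨j - 1, by omega⟩) ^ 2)) : ℝ) : EReal)
      ≤ Γ.deltaPrimeEigenvalue α n := by
  have hlen₁ : ∀ i, Γ.length (edge i) ≤ Γ.length (edge ⟨0, by omega⟩) := fun i =>
    hedge (Fin.mk_le_of_le_val (Nat.zero_le _))
  have hlen₂ : ∀ i : Fin (Fintype.card E), j - 1 ≤ (i : ℕ) →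
      Γ.length (edge i) ≤ Γ.length (edge ⟨j - 1, by omega⟩) := fun i hi =>
    hedge (Fin.mk_le_of_le_val hi)
  have hpos : ∀ i, 0 < Γ.length (edge i) := fun i => Γ.length_pos _
  have hE' : (2 : ℝ) ≤ Fintype.card E := by exact_mod_cast hE
  set t := ((Fintype.card V : ℝ) + 1) / (Fintype.card E : ℝ) with ht
  have ht0 : 0 < t := by positivity
  have htE : t * Fintype.card E = Fintype.card V + 1 := by rw [ht]; field_simp
  rcases hk with ⟨hα', m, hm, rfl⟩ | ⟨m, hm⟩
  · have hm' : (1 : ℝ) ≤ m := by exact_mod_cast hm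
    -- From `|V| ≤ |E| + 1` and `|E| ≥ 2`.
    have ht2 : t ≤ 2 := by
      rw [ht, div_le_iff₀ (by linarith)]
      have : (Fintype.card V : ℝ) ≤ Fintype.card E + 1 := by exact_mod_cast hΓ.card_vertices_le
      linarith
    have hn' : n = m * Fintype.card E + j := by exact_mod_cast hn
    refine Γ.le_deltaPrimeEigenvalue ∅ (fun v _ => (hα' v).le) edge (j := j) hm (by simp; omega)
      (fun i => ?_) (fun i hi => ?_)
    · refine (min_le_left _ _).trans (div_four_mul_sq_le_sq ?_ (hpos i) (hlen₁ i))
      rw [abs_le]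
      constructor <;> linarith
    -- The second term suffices when `|2m - 1 - 2t| ≤ 2m`. Otherwise `m = 1` and `t > 3/2`, so the
    -- base `3 - 2t` of the first term lies in `[-1, 0)` and that term is small enough.
    · by_cases hcase : 2 * t + 1 ≤ 4 * m
      · refine (min_le_right _ _).trans (div_four_mul_sq_le_sq ?_ (hpos i) (hlen₂ i hi))
        rw [abs_le]
        constructor <;> linarith
      · refine (min_le_left _ _).trans (div_four_mul_sq_le_sq ?_ (hpos i) (hlen₁ i))
        rw [abs_le]
        constructor <;> linarith
  · rw [hm]
    -- Here `k = m + 1 + t` and `t |E| = |V| + 1`: the `|V|` vertex functionals are absorbed by the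
    -- shift of the index.
    have hn' : n = (m + 1) * Fintype.card E + Fintype.card V + 1 + j := by
      have : (n : ℝ) = (m + 1) * Fintype.card E + Fintype.card V + 1 + j := by
        rw [hn]
        linear_combination (Fintype.card E : ℝ) * hm + htE
      exact_mod_cast this
    refine Γ.le_deltaPrimeEigenvalue Finset.univ (fun v hv => absurd (Finset.mem_univ v) hv) edge
      (m := m + 1) (j := j) (by omega) (by rw [Finset.card_univ]; omega) (fun i => ?_) (fun i hi => ?_)
    · refine (min_le_left _ _).trans (div_four_mul_sq_le_sq ?_ (hpos i) (hlen₁ i))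
      rw [abs_of_nonneg (by positivity)]
      push_cast
      linarith
    · refine (min_le_right _ _).trans (div_four_mul_sq_le_sq ?_ (hpos i) (hlen₂ i hi))
      rw [abs_of_nonneg (by positivity)]
      push_cast
      linarith
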